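/- Let $G$ be a finite simple graph on $n$ vertices. An acyclic orientation of $G$ assigns a direction to every edge of $G$ so that there is no directed cycle; a source (respectively sink) is a vertex with no incoming (respectively outgoing) edge, so isolated vertices are both. A double-flip of an acyclic orientation chooses a source $s$ and a sink $t$ that are distinct and nonadjacent in $G$, and reverses the direction of all edges incident to $s$ or $t$, turning $s$ into a sink and $t$ into a source. Two acyclic orientations of $G$ are double-flip equivalent if they are related by the equivalence relation generated by double-flips. There is a function $f:\mathbb{N}\to\mathbb{R}$ with $f(n)\to 0$ as $n\to\infty$ such that, for every $n$ and every $n$-vertex simple graph $G$, if two acyclic orientations $\alpha,\alpha''$ of $G$ are double-flip equivalent, then $\alpha''$ can be reached from $\alpha$ by a sequence of at most $4n^4(1+f(n))$ double-flips. -/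

import Mathlib

namespace DoubleFlips

/-- An orientation of a simple graph `G`: every edge of `G` is given exactly one of its two
directions. `dir u v` says that `uv` is an edge of `G` directed from `u` to `v`. -/
@[ext]
structure GraphOrientation {V : Type*} (G : SimpleGraph V) where
  dir : V → V → Prop
  adj_iff : ∀ u v, G.Adj u v ↔ (dir u v ∨ dir v u)
  asymm : ∀ u v, dir u v → ¬ dir v u

/-- An acyclic orientation of `G`: an orientation without directed cycles, that is, no vertex
can be reached from itself by a directed walk of positive length. -/
@[ext]
structure AcyclicOrientation {V : Type*} (G : SimpleGraph V) extends GraphOrientation G where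
  acyclic : ∀ v, ¬ Relation.TransGen dir v v

variable {V : Type*} {G : SimpleGraph V}

/-- `v` is a source: no edge is directed into `v` (isolated vertices are sources). -/
def IsSource (α : AcyclicOrientation G) (v : V) : Prop := ∀ u, ¬ α.dir u v

/-- `v` is a sink: no edge is directed out of `v` (isolated vertices are sinks). -/
def IsSink (α : AcyclicOrientation G) (v : V) : Prop := ∀ u, ¬ α.dir v u

/-- `β` results from `α` by one double-flip: for a source `s` and a sink `t` of `α` that are
distinct and nonadjacent, all edges incident to `s` or `t` are reversed (so that `s` becomes a
sink and `t` a source), and all other edges keep their direction. -/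
def DoubleFlip (α β : AcyclicOrientation G) : Prop :=
  ∃ s t : V, s ≠ t ∧ ¬ G.Adj s t ∧ IsSource α s ∧ IsSink α t ∧
    (∀ u v, (u = s ∨ u = t ∨ v = s ∨ v = t) → (β.dir u v ↔ α.dir v u)) ∧
    (∀ u v, ¬ (u = s ∨ u = t ∨ v = s ∨ v = t) → (β.dir u v ↔ α.dir u v))

/-- Double-flip equivalence: the equivalence relation on acyclic orientations generated by
double-flips. -/
def DoubleFlipEquiv (α β : AcyclicOrientation G) : Prop :=
  Relation.EqvGen DoubleFlip α β

/-- `β` is reached from `α` by a sequence of exactly `k` successive double-flips. -/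
def ReachableIn (k : ℕ) (α β : AcyclicOrientation G) : Prop :=
  ∃ γ : ℕ → AcyclicOrientation G,
    γ 0 = α ∧ γ k = β ∧ ∀ i < k, DoubleFlip (γ i) (γ (i + 1))

end DoubleFlips

/-! A double-flip equivalence yields an integer height `x` of sum zero: along an edge of `α` it
drops by one if `β` reverses the edge, and is constant otherwise. Within a component it varies by at
most `n`; rebalancing components reduces the overall spread to `3n`.

Given linear extensions `σ` of `α` and `τ` of `β`, place `v` at all positions congruent to `p v`
modulo `n`, with `p = σ` at the start and `q = τ - x n` at the end. Adjacent exchanges sort one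
periodic arrangement into the other. An exchange inside a period leaves the orientation unchanged;
one across its boundary is a double-flip. Edges are never exchanged, since both arrangements have
the same floors `(p u - p v) / n` on them. The inversion count is at most `n ^ 2 * (3 * n + 2)`, a
cubic bound that is stronger than needed. -/

namespace DoubleFlips

open Finset

/-! ### Height functions and their spread -/

section Heights

variable {V : Type*} {G : SimpleGraph V}

/-- `x` records how often each vertex has to be turned from a source into a sink (net count) in
order to get from `α` to `β`. -/
def IsHeight (α β : AcyclicOrientation G) (x : V → ℤ) : Prop :=
  ∀ u v, α.dir u v → (x u = x v ∧ β.dir u v) ∨ (x u = x v + 1 ∧ β.dir v u)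

theorem IsHeight.refl (α : AcyclicOrientation G) : IsHeight α α 0 :=
  fun _ _ h => Or.inl ⟨rfl, h⟩

theorem IsHeight.symm {α β : AcyclicOrientation G} {x : V → ℤ} (h : IsHeight α β x) :
    IsHeight β α (-x) := by
  intro u v huv
  have hn := β.asymm u v huv
  rcases (α.adj_iff u v).1 ((β.adj_iff u v).2 (Or.inl huv)) with h1 | h1
  · rcases h u v h1 with ⟨h2, -⟩ | ⟨-, h2⟩
    · exact Or.inl ⟨by simp [h2], h1⟩
    · exact absurd h2 hn
  · rcases h v u h1 with ⟨-, h2⟩ | ⟨h2, -⟩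
    · exact absurd h2 hn
    · exact Or.inr ⟨by simp [h2], h1⟩

/-- An edge reversed twice contributes jumps of opposite sign, which cancel. -/
theorem IsHeight.trans {α β γ : AcyclicOrientation G} {x y : V → ℤ} (h : IsHeight α β x)
    (h' : IsHeight β γ y) : IsHeight α γ (x + y) := by
  intro u v huv
  simp only [Pi.add_apply]
  rcases h u v huv with ⟨h1, h2⟩ | ⟨h1, h2⟩
  · rcases h' u v h2 with ⟨h3, h4⟩ | ⟨h3, h4⟩
    · exact Or.inl ⟨by omega, h4⟩
    · exact Or.inr ⟨by omega, h4⟩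
  · rcases h' v u h2 with ⟨h3, h4⟩ | ⟨h3, h4⟩
    · exact Or.inr ⟨by omega, h4⟩
    · exact Or.inl ⟨by omega, h4⟩

theorem DoubleFlip.exists_isHeight [Fintype V] {α β : AcyclicOrientation G}
    (h : DoubleFlip α β) : ∃ x : V → ℤ, ∑ v, x v = 0 ∧ IsHeight α β x := by
  classical
  obtain ⟨s, t, hst, hadj, hs, ht, h1, h2⟩ := h
  refine ⟨Pi.single s 1 - Pi.single t 1, by simp [Finset.sum_sub_distrib], ?_⟩
  intro u v huv
  have hvs : v ≠ s := fun e => hs u (e ▸ huv)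
  have hut : u ≠ t := fun e => ht v (e ▸ huv)
  have huv' : ¬ (u = s ∧ v = t) := by
    rintro ⟨rfl, rfl⟩
    exact hadj ((α.adj_iff _ _).2 (Or.inl huv))
  by_cases hus : u = s
  · have hvt : v ≠ t := fun e => huv' ⟨hus, e⟩
    exact Or.inr ⟨by simp [hus, hvs, hvt, hst],
      (h1 v u (by simp [hus])).2 huv⟩
  · by_cases hvt : v = t
    · exact Or.inr ⟨by simp [hus, hut, hvt, hst.symm],
        (h1 v u (by simp [hvt])).2 huv⟩
    · exact Or.inl ⟨by simp [hus, hut, hvt, hvs],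
        (h2 u v (by simp [hus, hut, hvt, hvs])).2 huv⟩

theorem DoubleFlipEquiv.exists_isHeight [Fintype V] {α β : AcyclicOrientation G}
    (h : DoubleFlipEquiv α β) : ∃ x : V → ℤ, ∑ v, x v = 0 ∧ IsHeight α β x := by
  induction h with
  | rel _ _ h => exact h.exists_isHeight
  | refl α => exact ⟨0, by simp, IsHeight.refl α⟩
  | symm _ _ _ ih =>
    obtain ⟨x, hx, h⟩ := ih
    exact ⟨-x, by simp [hx], h.symm⟩
  | trans _ _ _ _ _ ih ih' =>
    obtain ⟨x, hx, h⟩ := ih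
    obtain ⟨y, hy, h'⟩ := ih'
    exact ⟨x + y, by simp [Finset.sum_add_distrib, hx, hy], h.trans h'⟩

theorem IsHeight.sub_le_length {α β : AcyclicOrientation G} {x : V → ℤ} (h : IsHeight α β x)
    {u v : V} (w : G.Walk u v) : x u - x v ≤ w.length := by
  induction w with
  | nil => simp
  | @cons a b c hab w ih =>
    have : x a ≤ x b + 1 := by
      rcases (α.adj_iff a b).1 hab with h1 | h1
      · rcases h _ _ h1 with ⟨h2, -⟩ | ⟨h2, -⟩ <;> omega
      · rcases h _ _ h1 with ⟨h2, -⟩ | ⟨h2, -⟩ <;> omega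
    simp only [SimpleGraph.Walk.length_cons]
    push_cast
    omega

theorem IsHeight.sub_le_card [Fintype V] {α β : AcyclicOrientation G} {x : V → ℤ}
    (h : IsHeight α β x) {u v : V} (huv : G.Reachable u v) : x u - x v ≤ Fintype.card V := by
  classical
  obtain ⟨w, hw⟩ := huv.exists_isPath
  have := h.sub_le_length w
  have := hw.length_lt
  omega

/-- Heights may be shifted by a constant on each connected component. -/
theorem IsHeight.add_component {α β : AcyclicOrientation G} {x : V → ℤ} (h : IsHeight α β x)
    (c : G.ConnectedComponent → ℤ) :
    IsHeight α β (fun v => x v + c (G.connectedComponentMk v)) := by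
  intro u v huv
  have : G.connectedComponentMk u = G.connectedComponentMk v :=
    SimpleGraph.ConnectedComponent.sound ((α.adj_iff u v).2 (Or.inl huv)).reachable
  simp only [this]
  rcases h u v huv with ⟨h1, h2⟩ | ⟨h1, h2⟩
  · exact Or.inl ⟨by omega, h2⟩
  · exact Or.inr ⟨by omega, h2⟩

/-- A height function with minimal sum of squares has small spread. -/
theorem exists_isHeight_sub_le [Fintype V] {α β : AcyclicOrientation G}
    (h : ∃ x : V → ℤ, ∑ v, x v = 0 ∧ IsHeight α β x) :
    ∃ x : V → ℤ, ∑ v, x v = 0 ∧ IsHeight α β x ∧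
      ∀ u v, x u - x v ≤ 3 * (Fintype.card V : ℤ) := by
  classical
  obtain ⟨x, ⟨hx0, hx⟩, hmin⟩ := exists_minimalFor_of_wellFoundedLT
    (fun x : V → ℤ => ∑ v, x v = 0 ∧ IsHeight α β x) (fun x => ∑ v, (x v).natAbs ^ 2) h
  refine ⟨x, hx0, hx, fun u v => ?_⟩
  by_contra! hlt
  set n : ℤ := (Fintype.card V : ℤ) with hn
  have hn0 : 0 ≤ n := by positivity
  set A := univ.filter fun w => G.connectedComponentMk w = G.connectedComponentMk u with hA
  set B := univ.filter fun w => G.connectedComponentMk w = G.connectedComponentMk v with hB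
  have hne : G.connectedComponentMk u ≠ G.connectedComponentMk v := by
    intro e
    have := hx.sub_le_card (SimpleGraph.ConnectedComponent.exact e)
    omega
  set a : ℤ := (#A : ℤ) with ha
  set b : ℤ := (#B : ℤ) with hb
  have ha0 : 0 < a := by
    have : 0 < #A := Finset.card_pos.2 ⟨u, by simp [hA]⟩
    omega
  have hb0 : 0 < b := by
    have : 0 < #B := Finset.card_pos.2 ⟨v, by simp [hB]⟩
    omega
  have han : a ≤ n := by
    have := Finset.card_le_univ A
    omega
  have hbn : b ≤ n := by
    have := Finset.card_le_univ B
    omega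
  have hSA : a * (x u - n) ≤ ∑ w ∈ A, x w := by
    rw [ha, ← nsmul_eq_mul]
    refine Finset.card_nsmul_le_sum _ _ _ fun w hw => ?_
    have := hx.sub_le_card (SimpleGraph.ConnectedComponent.exact (Finset.mem_filter.1 hw).2.symm)
    omega
  have hSB : ∑ w ∈ B, x w ≤ b * (x v + n) := by
    rw [hb, ← nsmul_eq_mul]
    refine Finset.sum_le_card_nsmul _ _ _ fun w hw => ?_
    have := hx.sub_le_card (SimpleGraph.ConnectedComponent.exact (Finset.mem_filter.1 hw).2)
    omega
  -- Lowering `A` by its partner's size `b` and raising `B` by `a` keeps the total sum zero.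
  set c : G.ConnectedComponent → ℤ := fun K =>
    (if K = G.connectedComponentMk u then -b else 0) +
      (if K = G.connectedComponentMk v then a else 0) with hc
  have hsum : ∀ g : V → ℤ, ∑ w, g w * c (G.connectedComponentMk w) =
      -b * ∑ w ∈ A, g w + a * ∑ w ∈ B, g w := by
    intro g
    simp only [hc, mul_add, Finset.sum_add_distrib, mul_ite, mul_zero, ← Finset.sum_filter,
      ← Finset.sum_mul, ← hA, ← hB]
    ring
  have hsq : ∀ w, c (G.connectedComponentMk w) ^ 2 =
      (if G.connectedComponentMk w = G.connectedComponentMk u then b ^ 2 else 0) +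
      (if G.connectedComponentMk w = G.connectedComponentMk v then a ^ 2 else 0) := by
    intro w
    simp only [hc]
    by_cases h1 : G.connectedComponentMk w = G.connectedComponentMk u
    · simp [h1, hne]
    · simp only [h1, if_false, zero_add]
      split_ifs <;> simp
  have hsumsq : ∑ w, c (G.connectedComponentMk w) ^ 2 = a * b ^ 2 + b * a ^ 2 := by
    simp only [hsq, Finset.sum_add_distrib, ← Finset.sum_filter, ← hA, ← hB, Finset.sum_const,
      nsmul_eq_mul, ← ha, ← hb]
  have hnew : ∑ w, (x w + c (G.connectedComponentMk w)) = 0 := by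
    have := hsum (fun _ => 1)
    simp only [one_mul, Finset.sum_const, nsmul_eq_mul, mul_one, ← ha, ← hb] at this
    rw [Finset.sum_add_distrib, hx0, this]
    ring
  have hle : ∑ w, (x w + c (G.connectedComponentMk w)) ^ 2 < ∑ w, x w ^ 2 := by
    have : ∑ w, (x w + c (G.connectedComponentMk w)) ^ 2 =
        ∑ w, x w ^ 2 + 2 * ∑ w, x w * c (G.connectedComponentMk w) +
          ∑ w, c (G.connectedComponentMk w) ^ 2 := by
      rw [Finset.mul_sum, ← Finset.sum_add_distrib, ← Finset.sum_add_distrib]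
      exact Finset.sum_congr rfl fun w _ => by ring
    rw [this, hsum, hsumsq]
    have h1 := mul_le_mul_of_nonneg_left hSA hb0.le
    have h2 := mul_le_mul_of_nonneg_left hSB ha0.le
    -- The sum of squares drops by at least this product; it is positive since the spread exceeds `3
    -- * n` and `a + b ≤ 2 * n`.
    have h3 : 0 < a * b * (2 * (x u - x v - 2 * n) - (a + b)) :=
      mul_pos (mul_pos ha0 hb0) (by omega)
    linarith
  have hlt' : ∑ w, (x w + c (G.connectedComponentMk w)).natAbs ^ 2 <
      ∑ w, (x w).natAbs ^ 2 := by
    zify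
    simpa only [sq_abs] using hle
  exact absurd (hmin ⟨hnew, hx.add_component c⟩ hlt'.le) (not_le.2 hlt')

end Heights

/-! ### Sorting periodic arrangements -/

section Sorting

variable {V : Type*}

/-- The positions `p v` are pairwise distinct modulo `n`. -/
def InjMod (n : ℤ) (p : V → ℤ) : Prop := ∀ u v, n ∣ p u - p v → u = v

theorem InjMod.emod_ne {n : ℤ} {p : V → ℤ} (hp : InjMod n p) {u v : V} (h : u ≠ v) :
    p u % n ≠ p v % n :=
  fun e => h (hp u v (Int.ModEq.dvd (n := n) e.symm))

/-- The orientation of `G` along the order of the residues of the positions. -/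
def orient (G : SimpleGraph V) (n : ℤ) (p : V → ℤ) (hp : InjMod n p) :
    AcyclicOrientation G where
  dir u v := G.Adj u v ∧ p u % n < p v % n
  adj_iff u v := by
    constructor
    · intro h
      rcases lt_or_gt_of_ne (hp.emod_ne h.ne) with h1 | h1
      · exact Or.inl ⟨h, h1⟩
      · exact Or.inr ⟨h.symm, h1⟩
    · rintro (h | h)
      · exact h.1
      · exact h.1.symm
  asymm u v h h' := lt_asymm h.2 h'.2
  acyclic v h := by
    have : ∀ w, Relation.TransGen (fun u v => G.Adj u v ∧ p u % n < p v % n) v w →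
        p v % n < p w % n := by
      intro w hw
      induction hw with
      | single h => exact h.2
      | tail _ h ih => exact ih.trans h.2
    exact lt_irrefl _ (this v h)

theorem ReachableIn.head {G : SimpleGraph V} {α β γ : AcyclicOrientation G} {k : ℕ}
    (h : DoubleFlip α β) (h' : ReachableIn k β γ) : ReachableIn (k + 1) α γ := by
  obtain ⟨g, h0, hk, hg⟩ := h'
  refine ⟨fun i => Nat.casesOn i α g, rfl, hk, fun i hi => ?_⟩
  cases i with
  | zero => simpa [h0] using h
  | succ i => exact hg i (by omega)

theorem add_one_ediv_of_not_dvd {n z : ℤ} (hn : 0 < n) (h : ¬ n ∣ z + 1) :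
    (z + 1) / n = z / n := by
  have h1 := Int.emod_add_mul_ediv z n
  have h2 := Int.emod_nonneg z hn.ne'
  have h3 := Int.emod_lt_of_pos z hn
  have h4 : z % n + 1 ≠ n := by
    intro e
    exact h ⟨z / n + 1, by rw [mul_add]; omega⟩
  have h5 : z + 1 = (z % n + 1) + n * (z / n) := by omega
  conv_lhs => rw [h5]
  rw [Int.add_mul_ediv_left _ _ hn.ne', Int.ediv_eq_zero_of_lt (by omega) (by omega), zero_add]

theorem sub_one_ediv_of_not_dvd {n z : ℤ} (hn : 0 < n) (h : ¬ n ∣ z) :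
    (z - 1) / n = z / n := by
  have := add_one_ediv_of_not_dvd (z := z - 1) hn (by simpa using h)
  simpa using this.symm

theorem InjMod.exists_dvd_sub [Fintype V] {p : V → ℤ} {n : ℤ} (hn : n = Fintype.card V)
    (hn0 : 0 < n) (hp : InjMod n p) (i : ℤ) : ∃ v, n ∣ p v - i := by
  classical
  let g : V → Finset.Ico (0 : ℤ) n := fun v =>
    ⟨p v % n, Finset.mem_Ico.2 ⟨Int.emod_nonneg _ hn0.ne', Int.emod_lt_of_pos _ hn0⟩⟩
  have hg : Function.Injective g := by
    intro u v h
    by_contra hne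
    exact hp.emod_ne hne (congrArg Subtype.val h)
  have hb : Function.Bijective g :=
    (Fintype.bijective_iff_injective_and_card g).2 ⟨hg, by simp [hn]⟩
  obtain ⟨v, hv⟩ := hb.2 ⟨i % n, Finset.mem_Ico.2 ⟨Int.emod_nonneg _ hn0.ne',
    Int.emod_lt_of_pos _ hn0⟩⟩
  exact ⟨v, Int.ModEq.dvd (n := n) (congrArg Subtype.val hv).symm⟩

/-- If `p ≠ q` have the same sum, then two neighbouring entries of `p` are in the wrong order
with respect to `q`. -/
theorem InjMod.exists_descent [Fintype V] {p q : V → ℤ} {n : ℤ} (hn : n = Fintype.card V)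
    (hp : InjMod n p) (hq : InjMod n q) (hsum : ∑ v, p v = ∑ v, q v) (hne : p ≠ q) :
    ∃ u v k, p u + 1 = p v + k * n ∧ q v + k * n < q u := by
  classical
  by_contra! H
  apply hne
  rcases isEmpty_or_nonempty V with hV | hV
  · exact Subsingleton.elim _ _
  have hn0 : 0 < n := by
    have := Fintype.card_pos (α := V)
    omega
  -- Without a descent, the displacement `q - p` cannot decrease from one position to the next; by
  -- periodicity it is constant, and equal sums make it zero.
  have step : ∀ u v, n ∣ p u + 1 - p v → q u - p u ≤ q v - p v := by
    rintro u v ⟨k, hk⟩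
    rw [mul_comm] at hk
    have h1 := H u v k (by omega)
    by_cases huv : u = v
    · subst huv; rfl
    · have h2 : q u ≠ q v + k * n := fun e =>
        huv (hq u v ⟨k, by rw [mul_comm]; omega⟩)
      omega
  obtain ⟨v₀, hv₀⟩ := Finite.exists_max fun v => q v - p v
  have key : ∀ j : ℕ, ∀ w, n ∣ p v₀ + j - p w → q w - p w = q v₀ - p v₀ := by
    intro j
    induction j with
    | zero =>
      intro w hw
      rw [hp v₀ w (by simpa using hw)]
    | succ j ih =>
      intro w hw
      obtain ⟨u, hu⟩ := hp.exists_dvd_sub hn hn0 (p v₀ + j)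
      have h1 := ih u (by rwa [← dvd_neg, neg_sub])
      have h2 := step u w (by
        have hd := dvd_add hu hw
        rwa [show p u - (p v₀ + j) + (p v₀ + (j + 1 : ℕ) - p w) = p u + 1 - p w by
          push_cast; ring] at hd)
      have h3 := hv₀ w
      omega
  have hconst : ∀ w, q w - p w = q v₀ - p v₀ := by
    intro w
    refine key ((p w - p v₀) % n).toNat w ?_
    rw [Int.toNat_of_nonneg (Int.emod_nonneg _ hn0.ne')]
    refine ⟨-((p w - p v₀) / n), ?_⟩
    have := Int.emod_add_mul_ediv (p w - p v₀) n
    rw [mul_neg]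
    omega
  have h0 : ∑ w, (q w - p w) = 0 := by rw [Finset.sum_sub_distrib, hsum, sub_self]
  simp only [hconst, Finset.sum_const, Finset.card_univ, nsmul_eq_mul, ← hn] at h0
  have h1 : q v₀ - p v₀ = 0 := by
    rcases mul_eq_zero.1 h0 with h | h
    · omega
    · exact h
  funext w
  have := hconst w
  omega

/-- The number of (ordered) inversions between two periodic arrangements. -/
def invCount [Fintype V] (n : ℤ) (p q : V → ℤ) : ℕ :=
  ∑ z : V × V, ((p z.1 - p z.2) / n - (q z.1 - q z.2) / n).natAbs

/-- Exchange of two neighbouring entries. -/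
def exchange [DecidableEq V] (p : V → ℤ) (u v : V) : V → ℤ :=
  fun w => if w = u then p w + 1 else if w = v then p w - 1 else p w

section Exchange

variable [DecidableEq V] {p : V → ℤ} {u v : V} {n k : ℤ}

theorem exchange_left : exchange p u v u = p u + 1 := by simp [exchange]

theorem exchange_right (huv : u ≠ v) : exchange p u v v = p v - 1 := by
  simp [exchange, huv.symm]

theorem exchange_of_ne {w : V} (hu : w ≠ u) (hv : w ≠ v) : exchange p u v w = p w := by
  simp [exchange, hu, hv]

theorem exchange_eq_swap (huv : u ≠ v) (h : p u + 1 = p v + k * n) (w : V) :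
    n ∣ exchange p u v w - p (Equiv.swap u v w) := by
  rcases eq_or_ne w u with rfl | hu
  · rw [exchange_left, Equiv.swap_apply_left]
    exact ⟨k, by rw [mul_comm n]; omega⟩
  rcases eq_or_ne w v with rfl | hv
  · rw [exchange_right huv, Equiv.swap_apply_right]
    exact ⟨-k, by rw [mul_neg, mul_comm n]; omega⟩
  · rw [exchange_of_ne hu hv, Equiv.swap_apply_of_ne_of_ne hu hv, sub_self]
    exact dvd_zero n

theorem InjMod.exchange (hp : InjMod n p) (huv : u ≠ v) (h : p u + 1 = p v + k * n) :
    InjMod n (exchange p u v) := by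
  intro a b hab
  have ha := exchange_eq_swap huv h a
  have hb := exchange_eq_swap huv h b
  have : n ∣ p (Equiv.swap u v a) - p (Equiv.swap u v b) := by
    have hd := dvd_add (dvd_sub hab ha) hb
    rwa [show ∀ a b c d : ℤ, a - b - (a - c) + (b - d) = c - d by intros; ring] at hd
  exact (Equiv.swap u v).injective (hp _ _ this)

theorem sum_exchange [Fintype V] (huv : u ≠ v) : ∑ w, exchange p u v w = ∑ w, p w := by
  have : exchange p u v = p + Pi.single u 1 - Pi.single v 1 := by
    funext w
    simp only [DoubleFlips.exchange, Pi.add_apply, Pi.sub_apply, Pi.single_apply]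
    split_ifs with h1 h2 <;> first | omega | (exact absurd (h1.symm.trans h2) huv)
  simp [this, Finset.sum_add_distrib, Finset.sum_sub_distrib]

/-- The difference changes by at most one, and a floor could change only by crossing a multiple of
`n`, which distinct residues forbid. -/
theorem ediv_exchange (hn : 0 < n) (hp : InjMod n p) (huv : u ≠ v)
    (h : p u + 1 = p v + k * n) {a b : V} (h1 : ¬ (a = u ∧ b = v)) (h2 : ¬ (a = v ∧ b = u)) :
    (exchange p u v a - exchange p u v b) / n = (p a - p b) / n := by
  rcases eq_or_ne a b with rfl | hab
  · simp
  have hd : ∀ {a b : V}, a ≠ b → ¬ n ∣ p a - p b := fun hab hd => hab (hp _ _ hd)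
  rcases eq_or_ne a u with rfl | hau
  · have hbv : b ≠ v := fun e => h1 ⟨rfl, e⟩
    rw [exchange_left, exchange_of_ne hab.symm hbv, ← sub_add_eq_add_sub]
    refine add_one_ediv_of_not_dvd hn fun hdvd => hd hbv.symm ?_
    have hd := dvd_sub hdvd (Dvd.intro_left k rfl)
    rwa [show p a - p b + 1 - k * n = p v - p b by omega] at hd
  rcases eq_or_ne a v with rfl | hav
  · have hbu : b ≠ u := fun e => h2 ⟨rfl, e⟩
    rw [exchange_right huv, exchange_of_ne hbu hab.symm, sub_right_comm]
    exact sub_one_ediv_of_not_dvd hn (hd hab)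
  rw [exchange_of_ne hau hav]
  rcases eq_or_ne b u with rfl | hbu
  · rw [exchange_left, ← sub_sub]
    exact sub_one_ediv_of_not_dvd hn (hd hab)
  rcases eq_or_ne b v with rfl | hbv
  · rw [exchange_right huv, ← sub_add]
    refine add_one_ediv_of_not_dvd hn fun hdvd => hd hau ?_
    have hd := dvd_sub hdvd (Dvd.intro_left k rfl)
    rwa [show p a - p b + 1 - k * n = p a - p u by omega] at hd
  · rw [exchange_of_ne hbu hbv]

theorem ediv_of_descent (hn : 1 < n) (huv : u ≠ v) (h : p u + 1 = p v + k * n) :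
    (p u - p v) / n = k - 1 ∧ (p v - p u) / n = -k ∧
      (exchange p u v u - exchange p u v v) / n = k ∧
      (exchange p u v v - exchange p u v u) / n = -k - 1 := by
  rw [exchange_left, exchange_right huv]
  have key : ∀ {z c r : ℤ}, 0 ≤ r → r < n → z = r + c * n → z / n = c := by
    intro z c r h0 h1 hz
    rw [hz, Int.add_mul_ediv_right _ _ (by omega), Int.ediv_eq_zero_of_lt h0 h1, zero_add]
  refine ⟨key (r := n - 1) ?_ ?_ ?_, key (r := 1) ?_ ?_ ?_, key (r := 1) ?_ ?_ ?_,
    key (r := n - 1) ?_ ?_ ?_⟩ <;> first | omega | linarith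

/-- Only the floors of `(u, v)` and `(v, u)` change, each by one step towards its value for `q`. -/
theorem invCount_exchange_lt [Fintype V] {q : V → ℤ} (hn : 1 < n) (hp : InjMod n p)
    (huv : u ≠ v) (h : p u + 1 = p v + k * n) (hq : q v + k * n < q u) :
    invCount n (exchange p u v) q < invCount n p q := by
  obtain ⟨e1, e2, e3, e4⟩ := ediv_of_descent hn huv h
  have hq1 : k ≤ (q u - q v) / n := (Int.le_ediv_iff_mul_le (by omega)).2 (by omega)
  have hq2 : (q v - q u) / n < -k :=
    (Int.ediv_lt_iff_lt_mul (by omega)).2 (by rw [neg_mul]; omega)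
  unfold invCount
  refine Finset.sum_lt_sum ?_ ⟨(u, v), mem_univ _, ?_⟩
  · rintro ⟨a, b⟩ -
    dsimp only
    by_cases h1 : a = u ∧ b = v
    · obtain ⟨rfl, rfl⟩ := h1
      rw [e1, e3]
      omega
    by_cases h2 : a = v ∧ b = u
    · obtain ⟨rfl, rfl⟩ := h2
      rw [e2, e4]
      omega
    rw [ediv_exchange (by omega) hp huv h h1 h2]
  · dsimp only
    rw [e1, e3]
    omega

theorem orient_exchange {G : SimpleGraph V} (hn : 1 < n) (hp : InjMod n p) (huv : u ≠ v)
    (h : p u + 1 = p v + k * n) (hadj : ¬ G.Adj u v) :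
    orient G n (exchange p u v) (hp.exchange huv h) = orient G n p hp ∨
      DoubleFlip (orient G n p hp) (orient G n (exchange p u v) (hp.exchange huv h)) := by
  have hmod : ∀ w, exchange p u v w % n = p (Equiv.swap u v w) % n := fun w =>
    ((Int.emod_emod_of_dvd _ dvd_rfl).symm.trans
      (Int.ModEq.symm (Int.modEq_iff_dvd.2 (exchange_eq_swap huv h w)) ▸
        Int.emod_emod_of_dvd _ dvd_rfl))
  have hadj' : ¬ G.Adj v u := fun e => hadj e.symm
  have hu0 := Int.emod_nonneg (p u) (by omega : n ≠ 0)
  have hu1 := Int.emod_lt_of_pos (p u) (by omega : 0 < n)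
  have hv : p v % n = (p u % n + 1) % n := by
    rw [Int.emod_add_emod, h, Int.add_mul_emod_self_right]
  have hmu : exchange p u v u % n = p v % n := by rw [hmod, Equiv.swap_apply_left]
  have hmv : exchange p u v v % n = p u % n := by rw [hmod, Equiv.swap_apply_right]
  have hmw : ∀ w, w ≠ u → w ≠ v → exchange p u v w % n = p w % n := fun w h1 h2 => by
    rw [exchange_of_ne h1 h2]
  have hne := fun {a b : V} (hab : a ≠ b) => hp.emod_ne hab
  -- If `u` has residue `n - 1`, then `v` has residue `0`: `u` is a sink, `v` a source, and the
  -- exchange flips both. Otherwise no other vertex lies between them and the orientation is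
  -- unchanged.
  rcases eq_or_ne (p u % n + 1) n with hr | hr
  · right
    have hv0 : p v % n = 0 := by rw [hv, hr, Int.emod_self]
    have hb : ∀ w, 0 ≤ p w % n ∧ p w % n < n := fun w =>
      ⟨Int.emod_nonneg _ (by omega), Int.emod_lt_of_pos _ (by omega)⟩
    refine ⟨v, u, huv.symm, hadj', ?_, ?_, ?_, ?_⟩
    · rintro w ⟨-, hw⟩
      have := hb w
      omega
    · rintro w ⟨-, hw⟩
      have := hb w
      omega
    · intro a b hab
      change (G.Adj a b ∧ _) ↔ (G.Adj b a ∧ _)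
      rw [G.adj_comm b a]
      refine and_congr_right fun hG => ?_
      have hGne := hG.ne
      have h1 := hb a
      have h2 := hb b
      rcases eq_or_ne a u with rfl | hau
      · rcases eq_or_ne b v with rfl | hbv
        · exact absurd hG hadj
        · rw [hmu, hmw b hGne.symm hbv]
          have := hne hbv
          have := hne hGne
          omega
      rcases eq_or_ne a v with rfl | hav
      · rcases eq_or_ne b u with rfl | hbu
        · exact absurd hG hadj'
        · rw [hmv, hmw b hbu hGne.symm]
          have := hne hbu
          have := hne hGne
          omega
      rw [hmw a hau hav]
      rcases eq_or_ne b u with rfl | hbu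
      · rw [hmu]
        have := hne hau
        have := hne hav
        omega
      rcases eq_or_ne b v with rfl | hbv
      · rw [hmv]
        have := hne hau
        have := hne hav
        omega
      · simp_all
    · intro a b hab
      change (G.Adj a b ∧ _) ↔ (G.Adj a b ∧ _)
      simp only [not_or] at hab
      rw [hmw a hab.2.1 hab.1, hmw b hab.2.2.2 hab.2.2.1]
  · left
    have hv1 : p v % n = p u % n + 1 := by rw [hv, Int.emod_eq_of_lt (by omega) (by omega)]
    ext a b
    change (G.Adj a b ∧ _) ↔ (G.Adj a b ∧ _)
    refine and_congr_right fun hG => ?_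
    have hGne := hG.ne
    rcases eq_or_ne a u with rfl | hau
    · rcases eq_or_ne b v with rfl | hbv
      · exact absurd hG hadj
      · rw [hmu, hmw b hGne.symm hbv]
        have := hne hbv
        have := hne hGne
        omega
    rcases eq_or_ne a v with rfl | hav
    · rcases eq_or_ne b u with rfl | hbu
      · exact absurd hG hadj'
      · rw [hmv, hmw b hbu hGne.symm]
        have := hne hbu
        have := hne hGne
        omega
    rw [hmw a hau hav]
    rcases eq_or_ne b u with rfl | hbu
    · rw [hmu]
      have := hne hau
      have := hne hav
      omega
    rcases eq_or_ne b v with rfl | hbv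
    · rw [hmv]
      have := hne hau
      have := hne hav
      omega
    · rw [hmw b hbu hbv]

end Exchange

/-- Sorting one periodic arrangement into another by exchanges of neighbours, none of which
exchanges two adjacent vertices of `G`. -/
theorem exists_reachableIn_le_invCount [Fintype V] (G : SimpleGraph V) {n : ℤ}
    (hn : n = Fintype.card V) {p q : V → ℤ} (hp : InjMod n p) (hq : InjMod n q)
    (hsum : ∑ v, p v = ∑ v, q v)
    (hG : ∀ u v, G.Adj u v → (p u - p v) / n = (q u - q v) / n) :
    ∃ k ≤ invCount n p q, ReachableIn k (orient G n p hp) (orient G n q hq) := by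
  classical
  induction hN : invCount n p q using Nat.strong_induction_on generalizing p with
  | _ N ih =>
    subst hN
    by_cases hpq : p = q
    · subst hpq
      exact ⟨0, Nat.zero_le _, fun _ => orient G n p hp, rfl, rfl, by simp⟩
    obtain ⟨u, v, k, h, hlt⟩ := hp.exists_descent hn hq hsum hpq
    have huv : u ≠ v := by
      rintro rfl
      omega
    have hn1 : 1 < n := by
      have := Fintype.one_lt_card_iff.2 ⟨u, v, huv⟩
      omega
    -- At a descent the floor is `k - 1` for `p` but at least `k` for `q`, whereas on edges they
    -- agree.
    have hadj : ¬ G.Adj u v := by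
      intro e
      have h1 := hG u v e
      rw [(ediv_of_descent hn1 huv h).1] at h1
      have : k ≤ (q u - q v) / n := (Int.le_ediv_iff_mul_le (by omega)).2 (by omega)
      omega
    have hinv := invCount_exchange_lt hn1 hp huv h hlt
    obtain ⟨m, hm, hr⟩ := ih _ hinv (hp.exchange huv h) ((sum_exchange huv).trans hsum)
      (fun a b hab => by
        rw [ediv_exchange (by omega) hp huv h, hG a b hab]
        · rintro ⟨rfl, rfl⟩
          exact hadj hab
        · rintro ⟨rfl, rfl⟩
          exact hadj hab.symm) rfl
    rcases orient_exchange hn1 hp huv h hadj with e | e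
    · exact ⟨m, by omega, e ▸ hr⟩
    · exact ⟨m + 1, by omega, hr.head e⟩

end Sorting

/-! ### From heights to short flip sequences -/

/-- A linear extension of an acyclic orientation. -/
theorem AcyclicOrientation.exists_linear_extension {V : Type*} [Fintype V] {G : SimpleGraph V}
    (α : AcyclicOrientation G) : ∃ σ : V → ℤ, Function.Injective σ ∧
      (∀ v, 0 ≤ σ v ∧ σ v < Fintype.card V) ∧ ∀ u v, α.dir u v → σ u < σ v := by
  classical
  let P : PartialOrder V :=
    { le := Relation.ReflTransGen α.dir
      le_refl := fun _ => Relation.ReflTransGen.refl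
      le_trans := fun _ _ _ => Relation.ReflTransGen.trans
      le_antisymm := fun a b hab hba => by
        rcases Relation.reflTransGen_iff_eq_or_transGen.1 hab with h | h
        · exact h.symm
        · exact absurd (h.trans_left hba) (α.acyclic a) }
  let _ : Fintype (LinearExtension V) := inferInstanceAs (Fintype V)
  let e := (Fintype.orderIsoFinOfCardEq (LinearExtension V) rfl).symm
  have hlt : ∀ v, (e (toLinearExtension v) : ℕ) < Fintype.card V :=
    fun v => (e (toLinearExtension v)).2
  have hinj : Function.Injective fun v : V => ((e (toLinearExtension v) : ℕ) : ℤ) := by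
    intro u v h
    have : toLinearExtension u = toLinearExtension v :=
      e.injective (Fin.ext (Int.ofNat_injective h))
    exact this
  refine ⟨_, hinj, fun v => ⟨by positivity, by exact_mod_cast hlt v⟩, fun u v h => ?_⟩
  refine lt_of_le_of_ne ?_ fun h' => α.acyclic u ?_
  · have : u ≤ v := Relation.ReflTransGen.single h
    exact_mod_cast e.monotone (toLinearExtension.monotone this)
  · have := hinj h'
    subst this
    exact Relation.TransGen.single h

/-- Equivalent orientations with heights of spread at most `D` are close. -/
theorem IsHeight.exists_reachableIn {V : Type*} [Fintype V] {G : SimpleGraph V}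
    {α β : AcyclicOrientation G} {x : V → ℤ} (h : IsHeight α β x) (hx : ∑ v, x v = 0) {D : ℕ}
    (hD : ∀ u v, x u - x v ≤ D) :
    ∃ k ≤ Fintype.card V ^ 2 * (D + 2), ReachableIn k α β := by
  classical
  obtain ⟨σ, hσ, hσb, hσd⟩ := α.exists_linear_extension
  obtain ⟨τ, hτ, hτb, hτd⟩ := β.exists_linear_extension
  set n : ℤ := (Fintype.card V : ℤ) with hn
  have hmodσ : ∀ v, σ v % n = σ v := fun v => Int.emod_eq_of_lt (hσb v).1 (hσb v).2
  -- Each time `v` goes from source to sink it moves left into the preceding period, hence the shift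
  -- by `- x v * n`.
  have hmodτ : ∀ v, (τ v - x v * n) % n = τ v := fun v => by
    rw [Int.sub_mul_emod_self_right, Int.emod_eq_of_lt (hτb v).1 (hτb v).2]
  have inj : ∀ {p ρ : V → ℤ}, Function.Injective ρ → (∀ v, p v % n = ρ v) → InjMod n p := by
    intro p ρ hρ hpρ u v hd
    apply hρ
    rw [← hpρ, ← hpρ]
    exact (Int.modEq_iff_dvd.2 hd).symm
  have horient : ∀ {γ : AcyclicOrientation G} {p ρ : V → ℤ} (hp : InjMod n p),
      (∀ v, p v % n = ρ v) → (∀ u v, γ.dir u v → ρ u < ρ v) → orient G n p hp = γ := by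
    intro γ p ρ hp hpρ hγ
    ext u v
    change (G.Adj u v ∧ _) ↔ _
    rw [hpρ, hpρ, γ.adj_iff]
    constructor
    · rintro ⟨h1 | h1, h2⟩
      · exact h1
      · exact absurd (hγ _ _ h1) h2.not_gt
    · exact fun h1 => ⟨Or.inl h1, hγ _ _ h1⟩
  have hp := inj hσ hmodσ
  have hq := inj hτ hmodτ
  have hsum : ∑ v, σ v = ∑ v, (τ v - x v * n) := by
    have perm : ∀ {ρ : V → ℤ}, Function.Injective ρ → (∀ v, 0 ≤ ρ v ∧ ρ v < n) →
        ∑ v, ρ v = ∑ i ∈ Finset.Ico 0 n, i := by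
      intro ρ hρ hb
      have : univ.image ρ = Finset.Ico 0 n := by
        apply Finset.eq_of_subset_of_card_le
        · intro i hi
          obtain ⟨v, -, rfl⟩ := Finset.mem_image.1 hi
          exact Finset.mem_Ico.2 (hb v)
        · rw [Finset.card_image_of_injective _ hρ]
          simp [hn]
      rw [← this, Finset.sum_image fun a _ b _ e => hρ e]
    rw [Finset.sum_sub_distrib, ← Finset.sum_mul, hx, perm hσ hσb, perm hτ hτb]
    simp
  have key : ∀ {z c r : ℤ}, 0 ≤ r → r < n → z = r + c * n → z / n = c := by
    intro z c r h0 h1 hz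
    rw [hz, Int.add_mul_ediv_right _ _ (by omega), Int.ediv_eq_zero_of_lt h0 h1, zero_add]
  have hdir : ∀ u v, α.dir u v → (σ u - σ v) / n = (τ u - x u * n - (τ v - x v * n)) / n ∧
      (σ v - σ u) / n = (τ v - x v * n - (τ u - x u * n)) / n := by
    intro u v huv
    have h1 := hσd u v huv
    have h2 := hσb u
    have h3 := hσb v
    have h4 := hτb u
    have h5 := hτb v
    rw [key (z := σ u - σ v) (c := -1) (r := σ u - σ v + n) (by omega) (by omega) (by ring),
      key (z := σ v - σ u) (c := 0) (r := σ v - σ u) (by omega) (by omega) (by ring)]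
    rcases h u v huv with ⟨h6, h7⟩ | ⟨h6, h7⟩
    · have := hτd _ _ h7
      rw [h6, key (c := -1) (r := τ u - τ v + n) (by omega) (by omega) (by ring),
        key (c := 0) (r := τ v - τ u) (by omega) (by omega) (by ring)]
      simp
    · have := hτd _ _ h7
      rw [h6, key (c := -1) (r := τ u - τ v) (by omega) (by omega) (by ring),
        key (c := 0) (r := τ v - τ u + n) (by omega) (by omega) (by ring)]
      simp
  obtain ⟨k, hk, hr⟩ := exists_reachableIn_le_invCount G hn hp hq hsum fun u v huv => by
    rcases (α.adj_iff u v).1 huv with h1 | h1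
    · exact (hdir u v h1).1
    · exact (hdir v u h1).2
  rw [horient hp hmodσ hσd, horient hq hmodτ hτd] at hr
  refine ⟨k, hk.trans ?_, hr⟩
  unfold invCount
  -- Each floor is `-1` or `0` up to the shift `x v - x u`, so every ordered pair contributes at
  -- most `D + 2`.
  calc _ ≤ #(univ : Finset (V × V)) • (D + 2) := Finset.sum_le_card_nsmul _ _ _ ?_
    _ = _ := by simp [sq]
  rintro ⟨u, v⟩ -
  dsimp only
  have hn0 : 0 < n := (hσb u).1.trans_lt (hσb u).2
  have h2 := hσb u
  have h3 := hσb v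
  have h4 := hτb u
  have h5 := hτb v
  have b : ∀ {y : ℤ}, -n < y → y < n → -1 ≤ y / n ∧ y / n ≤ 0 := fun {y} h6 h7 =>
    ⟨(Int.le_ediv_iff_mul_le hn0).2 (by omega),
      Int.lt_add_one_iff.1 ((Int.ediv_lt_iff_lt_mul hn0).2 (by omega))⟩
  have e : τ u - x u * n - (τ v - x v * n) = (τ u - τ v) + (x v - x u) * n := by ring
  rw [e, Int.add_mul_ediv_right _ _ hn0.ne']
  have h6 := b (y := σ u - σ v) (by omega) (by omega)
  have h7 := b (y := τ u - τ v) (by omega) (by omega)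
  have h8 := hD u v
  have h9 := hD v u
  omega

end DoubleFlips

theorem corollary3p9 :
    ∃ f : ℕ → ℝ, Filter.Tendsto f Filter.atTop (nhds 0) ∧
      ∀ (n : ℕ) (V : Type*) [Fintype V], Fintype.card V = n →
        ∀ (G : SimpleGraph V) (α β : DoubleFlips.AcyclicOrientation G),
          DoubleFlips.DoubleFlipEquiv α β →
            ∃ k : ℕ, (k : ℝ) ≤ 4 * (n : ℝ) ^ 4 * (1 + f n) ∧
              DoubleFlips.ReachableIn k α β := by
  refine ⟨fun n => 1 / n, tendsto_one_div_atTop_nhds_zero_nat, ?_⟩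
  intro n V _ hn G α β h
  obtain ⟨x, hx0, hx, hD⟩ := DoubleFlips.exists_isHeight_sub_le h.exists_isHeight
  obtain ⟨k, hk, hr⟩ := hx.exists_reachableIn hx0 (D := 3 * n) (by simpa [hn] using hD)
  refine ⟨k, ?_, hr⟩
  rw [hn] at hk
  have hk' : (k : ℝ) ≤ (n : ℝ) ^ 2 * (3 * n + 2) := by exact_mod_cast hk
  refine hk'.trans ?_
  rcases Nat.eq_zero_or_pos n with rfl | hpos
  · simp
  have h1 : (1 : ℝ) ≤ n := by exact_mod_cast hpos
  have h2 : 4 * (n : ℝ) ^ 4 * (1 + 1 / n) = 4 * (n : ℝ) ^ 4 + 4 * (n : ℝ) ^ 3 := by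
    field_simp
  rw [h2]
  have h3 : (n : ℝ) ^ 2 ≤ (n : ℝ) ^ 4 := pow_le_pow_right₀ h1 (by norm_num)
  have h4 : 0 ≤ (n : ℝ) ^ 3 := by positivity
  nlinarith
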